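/- All maps are smooth and $S^1=\mathbb R/2\pi\mathbb Z$; functions on $S^1$ are identified with $2\pi$-periodic functions of $s\in\mathbb R$, and $D_s=\partial/\partial s$. Let $\mathcal M$ be the space of closed equicentroaffine plane curves, i.e. of maps $\gamma:S^1\to\mathbb R^2\setminus\{0\}$ with $\det\begin{pmatrix}\gamma\\ \gamma_s\end{pmatrix}=1$, and let $\kappa$, defined by $\gamma_{ss}=-\kappa\gamma$, be the equicentroaffine curvature of $\gamma$. Let $H_m:\mathcal M\to\mathbb R$ $(m=1,2,\dots)$ be the KdV Hamiltonians $H_m(\gamma)=\int_{S^1}h_m(\kappa,\kappa_s,\kappa_{ss},\dots)\,ds$, where $h_m=\frac1{2m-1}g_m$ and the differential polynomials $g_n$ in $\kappa$ are given by $g_0=1$ and $$g_{n+1}=\sum_{i+j=n}\Big(\tfrac12 g_i D_s^2g_j-\tfrac14 (D_sg_i)(D_sg_j)+\kappa g_ig_j\Big)-\tfrac12\sum_{\substack{i+j=n+1\\ i,j\ge1}}g_ig_j .$$ (Equivalently, $D_sg_{n+1}=(\frac12D_s^3+2\kappa D_s+\kappa_s)g_n$ with zero constants of integration, and $\delta H_m/\delta\kappa=g_{m-1}$;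 up to total derivatives $h_1=\kappa$, $h_2=\frac12\kappa^2$, $h_3=\frac12\kappa^3-\frac14\kappa_s^2$.) For real numbers $c_1,c_2,\dots$ and $m\ge1$ put $\mathcal M(C_m)=H_1^{-1}(c_1)\cap\dots\cap H_m^{-1}(c_m)$. For $\gamma\in\mathcal M(C_m)$ let $T_\gamma\mathcal M(C_m)$ be the common kernel of $dH_1,\dots,dH_m$ at $\gamma$: the set of velocities $X=\gamma_t|_{t=0}$ of smooth one-parameter families $\gamma(\cdot,t)\in\mathcal M$ with $\gamma(\cdot,0)=\gamma$ along which $\frac{d}{dt}\big|_{t=0}H_k(\gamma(\cdot,t))=0$ for $k=1,\dots,m$. Let $\Omega=\frac12D_s^2+2\kappa+\kappa_sD_s^{-1}$. For $\alpha:S^1\to\mathbb R$ put $\Omega\alpha_s=\frac12\alpha_{sss}+2\kappa\alpha_s+\kappa_s\alpha$ (that is, $D_s^{-1}\alpha_s=\alpha$); for $k\ge1$, $\Omega^{k+1}\alpha_s=\frac12D_s^2f+2\kappa f+\kappa_sp$, where $f=\Omega^k\alpha_s$ and $p$ is a function on $S^1$ with $p_s=f$, provided that such a $p$ exists; the constant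 of integration in $p$ is arbitrary. **Proposition.** Let $m\ge1$, $\gamma\in\mathcal M(C_m)$, and let $\alpha:S^1\to\mathbb R$ be such that $X=-\frac12\alpha_s\gamma+\alpha\gamma_s\in T_\gamma\mathcal M(C_m)$. Then $\Omega\alpha_s,\Omega^2\alpha_s,\dots,\Omega^{m+1}\alpha_s$ are defined as smooth functions on $S^1$; more precisely, whatever constants of integration are chosen, for each $k=1,\dots,m$ the function $\Omega^k\alpha_s$ has a primitive on $S^1$, so that $\Omega^{k+1}\alpha_s$ can be formed. Moreover, for every such choice, $$\int_{S^1}\Omega^k\alpha_s\,ds=0\qquad(k=1,\dots,m).$$ -/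

import Mathlib

open scoped ContDiff

namespace CentroAffine

/-- Smooth real functions on `S¹ = ℝ / 2πℤ`, regarded as smooth `2π`-periodic functions on `ℝ`. -/
structure IsCircleFun (f : ℝ → ℝ) : Prop where
  smooth : ContDiff ℝ ∞ f
  periodic : Function.Periodic f (2 * Real.pi)

/-- The determinant of the `2 × 2` matrix with rows `v` and `w`. -/
noncomputable def det₂ (v w : Fin 2 → ℝ) : ℝ := (Matrix.of ![v, w]).det

/-- The space of closed equicentroaffine plane curves: smooth maps `γ : S¹ → ℝ² \ {0}` with
`det (γ, γ_s) = 1`. -/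
structure IsCurve (γ : ℝ → Fin 2 → ℝ) : Prop where
  smooth : ContDiff ℝ ∞ γ
  periodic : Function.Periodic γ (2 * Real.pi)
  ne_zero : ∀ s, γ s ≠ 0
  det_eq_one : ∀ s, det₂ (γ s) (deriv γ s) = 1

/-- The equicentroaffine curvature. For a curve with `det (γ, γ_s) = 1` it is the function `κ`
with `γ_ss = -κ γ`, see `deriv_deriv_eq` below. -/
noncomputable def curvature (γ : ℝ → Fin 2 → ℝ) (s : ℝ) : ℝ :=
  det₂ (deriv γ s) (deriv (deriv γ) s)

theorem deriv_deriv_eq {γ : ℝ → Fin 2 → ℝ} (hγ : IsCurve γ) (s : ℝ) :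
    deriv (deriv γ) s = -(curvature γ s) • γ s := by
  have h1 : HasDerivAt γ (deriv γ s) s :=
    (hγ.smooth.differentiable (by simp) s).hasDerivAt
  have hs : ContDiff ℝ ∞ (deriv γ) := by
    have := hγ.smooth
    exact (contDiff_infty_iff_deriv.1 this).2
  have h2 : HasDerivAt (deriv γ) (deriv (deriv γ) s) s :=
    (hs.differentiable (by simp) s).hasDerivAt
  have e : ∀ t, γ t 0 * deriv γ t 1 - γ t 1 * deriv γ t 0 = 1 := by
    intro t
    have := hγ.det_eq_one t
    simpa [det₂, Matrix.det_fin_two] using this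
  have a := hasDerivAt_pi.1 h1
  have b := hasDerivAt_pi.1 h2
  have d := ((a 0).mul (b 1)).sub ((a 1).mul (b 0))
  have d' : HasDerivAt (fun _ : ℝ => (1 : ℝ)) _ s :=
    d.congr_of_eventuallyEq (Filter.Eventually.of_forall fun t => (e t).symm)
  have z := d'.unique (hasDerivAt_const s (1 : ℝ))
  have es := e s
  ext i
  fin_cases i <;> simp [curvature, det₂, Matrix.det_fin_two]
  · linear_combination (-deriv (deriv γ) s 0) * es + deriv γ s 0 * z
  · linear_combination (-deriv (deriv γ) s 1) * es + deriv γ s 1 * z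

/-! ### The KdV Hamiltonians -/

/-- Differential polynomials in one function `κ`; the variable `X i` stands for the `i`-th
derivative `D_s^i κ`. -/
abbrev DiffPoly : Type := MvPolynomial ℕ ℝ

namespace DiffPoly

/-- The total derivative `D_s`: the derivation with `D_s (D_s^i κ) = D_s^(i+1) κ`. -/
noncomputable def D : Derivation ℝ DiffPoly DiffPoly :=
  MvPolynomial.mkDerivation ℝ fun i => MvPolynomial.X (i + 1)

/-- The value of a differential polynomial on the function `κ`, at the point `s`. -/
noncomputable def evalAt (κ : ℝ → ℝ) (s : ℝ) (p : DiffPoly) : ℝ :=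
  MvPolynomial.aeval (fun i => iteratedDeriv i κ s) p

/-- The gradients `g₀ = 1, g₁ = κ, g₂ = κ_ss / 2 + 3 κ² / 2, …` of the KdV hierarchy.

They are the solution, with zero constants of integration, of the Lenard recursion
`D_s g_{n+1} = Ω D_s g_n = (D_s³ / 2 + 2 κ D_s + κ_s) g_n`, so that `D_s g_{n+1} = Ωⁿ κ_s`.
For `G = ∑ g_n λ⁻ⁿ` this recursion says `(D_s³ / 2 + 2 κ D_s + κ_s) G = λ D_s G`; multiplying by
`G` and integrating once gives
`(G D_s² G) / 2 - (D_s G)² / 4 + κ G² - λ G² / 2 = -λ / 2`, and the definition is the coefficient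
of `λ⁻ⁿ` in this identity, solved for `g_{n+1}`. -/
noncomputable def grad : ℕ → DiffPoly
  | 0 => 1
  | n + 1 =>
    (∑ i : Fin (n + 1),
      (MvPolynomial.C (1 / 2) * grad i * D (D (grad (n - i)))
        - MvPolynomial.C (1 / 4) * D (grad i) * D (grad (n - i))
        + MvPolynomial.X 0 * grad i * grad (n - i)))
    - MvPolynomial.C (1 / 2) * ∑ i : Fin n, grad (i + 1) * grad (n - i)
  termination_by n => n
  decreasing_by all_goals omega

/-- The density `h_m` (`m ≥ 1`) of the `m`-th KdV Hamiltonian, normalized so that the variational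
derivative of `∫ h_m ds` is `g_{m-1}`; thus the `n`-th KdV equation `κ_t = Ωⁿ κ_s` is
`κ_t = D_s (δH_{n+2} / δκ)`. Since the variational derivative of `∫ g_m ds` is
`(2 m - 1) g_{m-1}`, the density is `g_m / (2 m - 1)`. Up to total derivatives,
`h₁ = κ`, `h₂ = κ² / 2`, `h₃ = κ³ / 2 - κ_s² / 4`. -/
noncomputable def density (m : ℕ) : DiffPoly :=
  MvPolynomial.C (1 / (2 * (m : ℝ) - 1)) * grad m

end DiffPoly

/-- The KdV Hamiltonian `H_m = ∫_{S¹} h_m(κ, κ_s, κ_ss, …) ds`, as a function of the curve. -/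
noncomputable def H (m : ℕ) (γ : ℝ → Fin 2 → ℝ) : ℝ :=
  ∫ s in (0 : ℝ)..(2 * Real.pi), DiffPoly.evalAt (curvature γ) s (DiffPoly.density m)

/-- The joint level set `M(C_m) = H_1⁻¹(c_1) ∩ … ∩ H_m⁻¹(c_m)` in the space of closed
equicentroaffine curves. -/
def levelSet (c : ℕ → ℝ) (m : ℕ) : Set (ℝ → Fin 2 → ℝ) :=
  {γ | IsCurve γ ∧ ∀ k, 1 ≤ k → k ≤ m → H k γ = c k}

/-- `Γ` is a smooth one-parameter family of closed equicentroaffine curves that starts at `γ` with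
velocity `X`, i.e. `Γ 0 = γ` and `∂Γ/∂t = X` at `t = 0`. -/
structure IsMotion (γ X : ℝ → Fin 2 → ℝ) (Γ : ℝ → ℝ → Fin 2 → ℝ) : Prop where
  smooth : ContDiff ℝ ∞ (fun p : ℝ × ℝ => Γ p.1 p.2)
  isCurve : ∀ t, IsCurve (Γ t)
  start : Γ 0 = γ
  velocity : ∀ s, deriv (fun t => Γ t s) 0 = X s

/-- The tangent space of `M(C_m)` at `γ`: the intersection of the kernels of the differentials
`dH_1, …, dH_m` at `γ`, that is, the velocities `X` of smooth motions of closed equicentroaffine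
curves starting at `γ` along which the derivative of each of `H_1, …, H_m` at time `0` is `0`.
(The motion need not stay in `M(C_m)`.) -/
def tangentSpace (m : ℕ) (γ : ℝ → Fin 2 → ℝ) : Set (ℝ → Fin 2 → ℝ) :=
  {X | ∃ Γ, IsMotion γ X Γ ∧
    ∀ k, 1 ≤ k → k ≤ m → HasDerivAt (fun t => H k (Γ t)) 0 0}

/-- The field `-½ α_s γ + α γ_s` along `γ`. -/
noncomputable def fieldOf (γ : ℝ → Fin 2 → ℝ) (α : ℝ → ℝ) (s : ℝ) : Fin 2 → ℝ :=
  (-(1 / 2) * deriv α s) • γ s + α s • deriv γ s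

/-! ### The recursion operator -/

/-- `½ D_s² f + 2 κ f + κ_s p`: the value of the recursion operator
`Ω = ½ D_s² + 2 κ + κ_s D_s⁻¹` on `f`, when `p` is taken for `D_s⁻¹ f`. -/
noncomputable def omega (κ f p : ℝ → ℝ) (s : ℝ) : ℝ :=
  1 / 2 * deriv (deriv f) s + 2 * κ s * f s + deriv κ s * p s

/-- `IsOmegaPower κ α k f`: the function `f` is a value of `Ω^k α_s`, where `k ≥ 1`.
The first step uses `D_s⁻¹ α_s = α`, so `Ω α_s = ½ α_sss + 2 κ α_s + κ_s α`. Each further step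
needs a primitive of `Ω^k α_s` that is a function on `S¹`; every choice of the constant of
integration is admitted. -/
inductive IsOmegaPower (κ α : ℝ → ℝ) : ℕ → (ℝ → ℝ) → Prop
  | one : IsOmegaPower κ α 1 (omega κ (deriv α) α)
  | succ {k : ℕ} {f p : ℝ → ℝ} (hf : IsOmegaPower κ α k f) (hp : IsCircleFun p)
      (hpf : deriv p = f) : IsOmegaPower κ α (k + 1) (omega κ f p)

end CentroAffine

/-!
The generating function of the gradients `g_n` is the diagonal of the resolvent of the Schrödinger
operator with potential `κ`. Varying the resolvent equation gives `δ g_{n+1} = (2 n + 1) g_n δ κ`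
up to a total derivative, so `dH_{n+1}` pairs `g_n` with `κ_t`. The field
`-½ α_s γ + α γ_s` moves the curvature by `κ_t = Ω α_s`. Since `Ω D_s` is skew-symmetric and
`D_s g_{n+1} = Ω D_s g_n`, powers of `Ω` can be moved onto the gradients, starting from `g_0 = 1`:
`∫ Ω^k α_s = ∫ g_{k-1} Ω α_s = dH_k (X) = 0`, whatever constants of integration were chosen. The
vanishing of this integral is what lets `Ω^k α_s` be integrated once more on `S¹`.
-/

namespace CentroAffine

section DifferentialAlgebra

variable {𝕜 A B : Type*} [CommRing 𝕜] [CommRing A] [Algebra 𝕜 A] [CommRing B] [Algebra 𝕜 B]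
  {D δ θ : Derivation 𝕜 A A} {D' : Derivation 𝕜 B B}

theorem derivation_ofNat (D : Derivation 𝕜 A A) (n : ℕ) [n.AtLeastTwo] :
    D (OfNat.ofNat n) = 0 := by
  rw [← Nat.cast_ofNat (R := A)]
  exact D.map_natCast n

/-- The operator `D³ + 4 k D + 2 (D k)`, which is `2 Ω D` for the recursion operator
`Ω = ½ D² + 2 k + (D k) D⁻¹`; the factor `2` keeps fractions out of the coefficients. -/
def lenardOp (D : Derivation 𝕜 A A) (k a : A) : A :=
  D (D (D a)) + 4 * k * D a + 2 * D k * a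

theorem map_lenardOp (f : A →ₐ[𝕜] B) (hf : ∀ a, f (D a) = D' (f a)) (k a : A) :
    f (lenardOp D k a) = lenardOp D' (f k) (f a) := by
  simp only [lenardOp, map_add, map_mul, map_ofNat, hf]

theorem exists_mul_lenardOp_add_eq_deriv (D : Derivation 𝕜 A A) (k a b : A) :
    ∃ w, a * lenardOp D k b + lenardOp D k a * b = D w := by
  refine ⟨a * D (D b) - D a * D b + D (D a) * b + 4 * k * a * b, ?_⟩
  simp only [lenardOp, D.leibniz, map_add, map_sub, derivation_ofNat D, smul_eq_mul]
  ring

/-- `G` is the diagonal of the resolvent of the Schrödinger operator with potential `k`, as a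
function of the inverse `z` of the spectral parameter and normalized to be `1` at `z = 0`:
it solves `½ G G'' - ¼ G'² + k G² = (G² - 1) / (2 z)`, here multiplied by `4 z`. -/
structure IsResolvent (D : Derivation 𝕜 A A) (z k G : A) : Prop where
  isUnit : IsUnit G
  deriv_param : D z = 0
  eq : z * (2 * G * D (D G) - D G ^ 2 + 4 * k * G ^ 2) = 2 * G ^ 2 - 2

namespace IsResolvent

variable {z k G : A}

theorem map (h : IsResolvent D z k G) (f : A →+* B) (hf : ∀ a, f (D a) = D' (f a)) :
    IsResolvent D' (f z) (f k) (f G) where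
  isUnit := h.isUnit.map f
  deriv_param := by rw [← hf, h.deriv_param, map_zero]
  eq := by simpa only [map_mul, map_add, map_sub, map_pow, map_ofNat, hf] using congrArg f h.eq

theorem two_mul_deriv_eq (h : IsResolvent D z k G) (h2 : IsUnit (2 : A)) :
    2 * D G = z * lenardOp D k G := by
  have hD := congrArg D h.eq
  simp only [D.leibniz, D.leibniz_pow, map_add, map_sub, derivation_ofNat D, h.deriv_param,
    smul_eq_mul, nsmul_eq_mul] at hD
  push_cast at hD
  refine (h2.mul h.isUnit).mul_left_cancel ?_
  rw [lenardOp]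
  linear_combination -hD

/-- The linearization of the resolvent equation, which is self-adjoint in the logarithmic
derivative `W` of `G`. -/
theorem linearized_eq (h : IsResolvent D z k G) (h2 : IsUnit (2 : A))
    (hδD : ∀ a, δ (D a) = D (δ a)) {c W : A} (hz : δ z = c * z) (hW : δ G = G * W) :
    z * (G * D (G * D W)) - 2 * W = c * (1 - G ^ 2) - 2 * z * δ k * G ^ 2 := by
  have hδ := congrArg δ h.eq
  simp only [D.leibniz, δ.leibniz, δ.leibniz_pow, map_add, map_sub, derivation_ofNat δ,
    hδD, hz, hW, smul_eq_mul, nsmul_eq_mul] at hδ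
  push_cast at hδ
  refine h2.mul_left_cancel ?_
  simp only [D.leibniz, smul_eq_mul]
  linear_combination hδ - (2 * W + c) * h.eq

/-- Here `δ` varies the potential and `θ` is the Euler derivation in the spectral parameter. The
total derivative is the Wronskian of the two logarithmic derivatives `δ G / G` and `θ G / G`, which
solve the same self-adjoint equation with different right-hand sides. -/
theorem exists_variation_eq (h : IsResolvent D z k G) (h2 : IsUnit (2 : A))
    (hδD : ∀ a, δ (D a) = D (δ a)) (hδz : δ z = 0)
    (hθD : ∀ a, θ (D a) = D (θ a)) (hθz : θ z = z) (hθk : θ k = 0) :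
    ∃ w, δ G = z * (δ k * (G + 2 * θ G) + D w) := by
  obtain ⟨U, hU⟩ := h.isUnit.dvd (a := δ G)
  obtain ⟨V, hV⟩ := h.isUnit.dvd (a := θ G)
  have eqU := h.linearized_eq h2 hδD (c := 0) (by simpa using hδz) hU
  have eqV := h.linearized_eq h2 hθD (c := 1) (by simpa using hθz) hV
  obtain ⟨c, hc⟩ := h2.dvd (a := 1)
  have hDc : D c = 0 := by
    rw [D.leibniz_of_mul_eq_one (mul_comm c 2 ▸ hc.symm), derivation_ofNat, smul_zero]
  refine ⟨c * (G * D U) - G * (U * D V - V * D U), h.isUnit.mul_left_cancel ?_⟩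
  rw [hU, hV]
  simp only [D.leibniz, map_sub, hDc, hθk, smul_eq_mul] at eqU eqV ⊢
  linear_combination U * eqV - (V + c) * eqU + (U - z * δ k * G ^ 2) * hc

end IsResolvent

/-- The curvature `det (γ', γ'')` of the curve `γ = (x, y)` whose coordinates lie in a
differential ring. -/
def wronskianCurvature (D : Derivation 𝕜 A A) (x y : A) : A := D x * D (D y) - D y * D (D x)

theorem deriv_deriv_eq_neg_wronskianCurvature_mul {x y : A} (h : x * D y - y * D x = 1) :
    D (D x) = -(wronskianCurvature D x y * x) ∧ D (D y) = -(wronskianCurvature D x y * y) := by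
  have hD : x * D (D y) - y * D (D x) = 0 := by
    have := congrArg D h
    simp only [D.leibniz, map_sub, D.map_one_eq_zero, smul_eq_mul] at this
    linear_combination this
  constructor
  · rw [wronskianCurvature]
    linear_combination D x * hD - D (D x) * h
  · rw [wronskianCurvature]
    linear_combination D y * hD - D (D y) * h

theorem deriv_mul_add_mul_deriv {k u : A} (hu : D (D u) = -(k * u)) (p q : A) :
    D (p * u + q * D u) = (D p - k * q) * u + (p + D q) * D u := by
  simp only [D.leibniz, map_add, hu, smul_eq_mul]
  ring

/-- A variation `δ γ = a γ + b γ'` that preserves `det (γ, γ') = 1` has `2 a = -b'`, so only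
`b = det (γ, δ γ)` enters. -/
theorem two_mul_variation_wronskianCurvature {x y : A} (hδD : ∀ a, δ (D a) = D (δ a))
    (h : x * D y - y * D x = 1) :
    2 * δ (wronskianCurvature D x y) =
      lenardOp D (wronskianCurvature D x y) (x * δ y - y * δ x) := by
  obtain ⟨hx, hy⟩ := deriv_deriv_eq_neg_wronskianCurvature_mul h
  set k := wronskianCurvature D x y
  set a := δ x * D y - δ y * D x with ha
  set b := x * δ y - y * δ x with hb
  have hδx : δ x = a * x + b * D x := by linear_combination x * ha + D x * hb - δ x * h
  have hδy : δ y = a * y + b * D y := by linear_combination y * ha + D y * hb - δ y * h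
  have transversal : 2 * a = -D b := by
    have hδ := congrArg δ h
    simp only [δ.leibniz, map_sub, δ.map_one_eq_zero, hδD, smul_eq_mul] at hδ
    simp only [ha, hb, D.leibniz, map_sub, smul_eq_mul]
    linear_combination hδ
  clear_value a b
  have hx'' := congrArg δ hx
  have hy'' := congrArg δ hy
  simp only [δ.leibniz, map_neg, hδD, hδx, hδy, deriv_mul_add_mul_deriv hx,
    deriv_mul_add_mul_deriv hy, smul_eq_mul] at hx'' hy''
  have variation : δ k = k * D b - D (D a - k * b) := by
    linear_combination D y * hx'' - D x * hy'' + (k * D b - D (D a - k * b) - δ k) * h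
  have transversal'' : 2 * D (D a) = -D (D (D b)) := by
    simpa only [two_mul, map_add, map_neg] using congrArg (fun u => D (D u)) transversal
  rw [variation, lenardOp, map_sub, D.leibniz, smul_eq_mul, smul_eq_mul]
  linear_combination -transversal''

end DifferentialAlgebra

section GradSequence

open PowerSeries Finset

variable {𝕜 R S : Type*} [CommRing 𝕜] [CommRing R] [Algebra 𝕜 R] [CommRing S] [Algebra 𝕜 S]

theorem isUnit_two_powerSeries (h2 : IsUnit (2 : R)) : IsUnit (2 : R⟦X⟧) := by
  have := h2.map (C (R := R))
  rwa [map_ofNat] at this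

/-- The extension of a derivation of `R` to `R⟦X⟧` that acts on the coefficients and treats the
spectral parameter `X` as a constant. -/
noncomputable def coeffwise (D : Derivation 𝕜 R R) : Derivation 𝕜 R⟦X⟧ R⟦X⟧ :=
  Derivation.mk'
    { toFun := fun f => PowerSeries.mk fun n => D (coeff n f)
      map_add' := fun f g => by ext n; simp
      map_smul' := fun r f => by ext n; simp }
    fun f g => by
      ext n
      simp only [LinearMap.coe_mk, AddHom.coe_mk, coeff_mk, coeff_mul, map_sum, D.leibniz,
        smul_eq_mul, map_add, sum_add_distrib]
      congr 1
      rw [← Finset.Nat.sum_antidiagonal_swap]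
      rfl

@[simp]
theorem coeff_coeffwise (D : Derivation 𝕜 R R) (f : R⟦X⟧) (n : ℕ) :
    coeff n (coeffwise D f) = D (coeff n f) := by
  simp [coeffwise]

@[simp]
theorem coeffwise_C (D : Derivation 𝕜 R R) (a : R) : coeffwise D (C a) = C (D a) := by
  ext n
  rw [coeff_coeffwise, coeff_C, coeff_C]
  split_ifs <;> simp

theorem coeffwise_X (D : Derivation 𝕜 R R) : coeffwise D (X : R⟦X⟧) = 0 := by
  ext n
  rw [coeff_coeffwise, coeff_X]
  split_ifs <;> simp

theorem coeff_lenardOp_coeffwise (D : Derivation 𝕜 R R) (k : R) (f : R⟦X⟧) (n : ℕ) :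
    coeff n (lenardOp (coeffwise D) (C k) f) = lenardOp D k (coeff n f) := by
  have two : (2 : R⟦X⟧) = C 2 := (map_ofNat _ 2).symm
  have four : (4 : R⟦X⟧) = C 4 := (map_ofNat _ 4).symm
  simp only [lenardOp, two, four, map_add, mul_assoc, coeff_C_mul, coeffwise_C, coeff_coeffwise]

/-- The derivation `X d/dX` of `R⟦X⟧`. -/
noncomputable def eulerDerivation (𝕜 R : Type*) [CommRing 𝕜] [CommRing R] [Algebra 𝕜 R] :
    Derivation 𝕜 R⟦X⟧ R⟦X⟧ :=
  (X : R⟦X⟧) • (PowerSeries.derivative R).restrictScalars 𝕜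

theorem coeff_eulerDerivation (f : R⟦X⟧) (n : ℕ) :
    coeff n (eulerDerivation 𝕜 R f) = n * coeff n f := by
  cases n with
  | zero => simp [eulerDerivation]
  | succ n =>
    simp only [eulerDerivation, Derivation.smul_apply, Derivation.restrictScalars_apply,
      smul_eq_mul, coeff_succ_X_mul, coeff_derivative]
    push_cast
    ring

/-- `g` is the sequence of gradients of the KdV hierarchy with potential `k`, in a ring with
derivation `D`: its generating function solves the resolvent equation. -/
def IsGradSequence (D : Derivation 𝕜 R R) (k : R) (g : ℕ → R) : Prop :=
  IsResolvent (coeffwise D) X (C k) (PowerSeries.mk g)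

namespace IsGradSequence

variable {D δ : Derivation 𝕜 R R} {k : R} {g : ℕ → R}

theorem map (h : IsGradSequence D k g) {D' : Derivation 𝕜 S S} (f : R →+* S)
    (hf : ∀ a, f (D a) = D' (f a)) : IsGradSequence D' (f k) fun n => f (g n) := by
  have hmk : PowerSeries.map f (PowerSeries.mk g) = PowerSeries.mk fun n => f (g n) := by
    ext n; simp
  simpa only [IsGradSequence, map_X, map_C, hmk] using
    IsResolvent.map h (PowerSeries.map f) (D' := coeffwise D') fun a => by ext n; simp [hf]

theorem two_mul_deriv_succ (h : IsGradSequence D k g) (h2 : IsUnit (2 : R)) (n : ℕ) :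
    2 * D (g (n + 1)) = lenardOp D k (g n) := by
  have := congrArg (coeff (n + 1)) (h.two_mul_deriv_eq (isUnit_two_powerSeries h2))
  simpa only [two_mul, map_add, coeff_succ_X_mul, coeff_lenardOp_coeffwise, coeff_coeffwise,
    coeff_mk] using this

theorem exists_variation_succ_eq (h : IsGradSequence D k g) (h2 : IsUnit (2 : R))
    (hδ : ∀ a, δ (D a) = D (δ a)) (n : ℕ) :
    ∃ w, δ (g (n + 1)) = (2 * n + 1) * (g n * δ k) + D w := by
  obtain ⟨W, hW⟩ := h.exists_variation_eq (isUnit_two_powerSeries h2)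
    (δ := coeffwise δ) (θ := eulerDerivation 𝕜 R)
    (fun f => by ext n; simp [hδ]) (coeffwise_X δ)
    (fun f => by ext n; simp [coeff_eulerDerivation])
    (by simp [eulerDerivation]) (by simp [eulerDerivation])
  refine ⟨coeff n W, ?_⟩
  have := congrArg (coeff (n + 1)) hW
  simp only [two_mul, coeff_succ_X_mul, map_add, coeffwise_C, coeff_C_mul, coeff_coeffwise,
    coeff_eulerDerivation, coeff_mk] at this
  rw [this]
  ring

end IsGradSequence

end GradSequence

namespace DiffPoly

open MvPolynomial Finset

theorem isUnit_two (A : Type*) [CommRing A] [Algebra ℝ A] : IsUnit (2 : A) := by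
  have := (IsUnit.mk0 (2 : ℝ) two_ne_zero).map (algebraMap ℝ A)
  rwa [map_ofNat] at this

theorem sum_antidiagonal_grad_mul_grad (n : ℕ) :
    ∑ p ∈ antidiagonal (n + 1), grad p.1 * grad p.2 =
      2 * grad (n + 1) + ∑ i ∈ range n, grad (i + 1) * grad (n - i) := by
  have grad_zero : grad 0 = 1 := by rw [grad]
  rw [Nat.sum_antidiagonal_eq_sum_range_succ_mk, sum_range_succ', sum_range_succ]
  simp only [Nat.sub_self, Nat.sub_zero, Nat.add_sub_add_right, grad_zero]
  ring

theorem sum_antidiagonal_grad (n : ℕ) :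
    ∑ p ∈ antidiagonal n, (2 * grad p.1 * D (D (grad p.2)) - D (grad p.1) * D (grad p.2)
      + 4 * X 0 * (grad p.1 * grad p.2)) =
    2 * ∑ p ∈ antidiagonal (n + 1), grad p.1 * grad p.2 := by
  have hrec := grad.eq_2 n
  rw [Fin.sum_univ_eq_sum_range (fun i => C (1 / 2) * grad i * D (D (grad (n - i)))
      - C (1 / 4) * D (grad i) * D (grad (n - i)) + X 0 * grad i * grad (n - i)),
    Fin.sum_univ_eq_sum_range (fun i => grad (i + 1) * grad (n - i))] at hrec
  have half : (2 : DiffPoly) * C (1 / 2) = 1 := by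
    rw [← map_ofNat C 2, ← map_mul]; norm_num
  have quarter : (4 : DiffPoly) * C (1 / 4) = 1 := by
    rw [← map_ofNat C 4, ← map_mul]; norm_num
  calc
    _ = 4 * ∑ i ∈ range (n + 1), (C (1 / 2) * grad i * D (D (grad (n - i)))
        - C (1 / 4) * D (grad i) * D (grad (n - i)) + X 0 * grad i * grad (n - i)) := by
      rw [Nat.sum_antidiagonal_eq_sum_range_succ_mk, mul_sum]
      refine sum_congr rfl fun i _ => ?_
      linear_combination -2 * grad i * D (D (grad (n - i))) * half
        + D (grad i) * D (grad (n - i)) * quarter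
    _ = _ := by
      rw [sum_antidiagonal_grad_mul_grad]
      linear_combination (-4) * hrec + 2 * (∑ i ∈ range n, grad (i + 1) * grad (n - i)) * half

theorem isGradSequence_grad : IsGradSequence D (X 0) grad where
  isUnit := by
    rw [PowerSeries.isUnit_iff_constantCoeff, ← PowerSeries.coeff_zero_eq_constantCoeff_apply,
      PowerSeries.coeff_mk, grad]
    exact isUnit_one
  deriv_param := coeffwise_X D
  eq := by
    have two : (2 : PowerSeries DiffPoly) = PowerSeries.C 2 := (map_ofNat _ 2).symm
    have four : (4 : PowerSeries DiffPoly) = PowerSeries.C 4 := (map_ofNat _ 4).symm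
    ext1 n
    rw [two, four]
    cases n with
    | zero =>
      rw [PowerSeries.coeff_zero_X_mul]
      simp [pow_two, PowerSeries.coeff_mul, grad, -PowerSeries.coeff_zero_eq_constantCoeff]
    | succ n =>
      have := sum_antidiagonal_grad n
      simp only [sum_add_distrib, sum_sub_distrib, mul_assoc, ← mul_sum] at this
      rw [PowerSeries.coeff_succ_X_mul]
      simp only [map_add, map_sub, mul_assoc, PowerSeries.coeff_C_mul, pow_two,
        PowerSeries.coeff_succ_C, sub_zero]
      simpa only [PowerSeries.coeff_mul, PowerSeries.coeff_mk, coeff_coeffwise] using this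

section EvalIn

variable {A B : Type*} [CommRing A] [Algebra ℝ A] [CommRing B] [Algebra ℝ B]

/-- The value of a differential polynomial on an element `k` of a ring with derivation `D`. -/
noncomputable def evalIn (D : Derivation ℝ A A) (k : A) : DiffPoly →ₐ[ℝ] A :=
  aeval fun i => D^[i] k

theorem evalIn_D (D : Derivation ℝ A A) (k : A) (p : DiffPoly) :
    evalIn D k (DiffPoly.D p) = D (evalIn D k p) := by
  induction p using MvPolynomial.induction_on with
  | C a => simp [evalIn, ← algebraMap_eq]
  | add p q hp hq => simp only [map_add, hp, hq]
  | mul_X p i hp =>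
    have hX : evalIn D k (DiffPoly.D (X i)) = D (evalIn D k (X i)) := by
      simp [evalIn, DiffPoly.D, mkDerivation_X, Function.iterate_succ_apply']
    simp only [Derivation.leibniz, map_mul, smul_eq_mul, map_add, hp, hX]

theorem map_evalIn {D : Derivation ℝ A A} {D' : Derivation ℝ B B} (f : A →ₐ[ℝ] B)
    (hf : ∀ a, f (D a) = D' (f a)) (k : A) (p : DiffPoly) :
    f (evalIn D k p) = evalIn D' (f k) p := by
  rw [evalIn, comp_aeval_apply, evalIn]
  congr 2 with i
  exact Function.Semiconj.iterate_right hf i k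

theorem isGradSequence_evalIn (D : Derivation ℝ A A) (k : A) :
    IsGradSequence D k fun n => evalIn D k (grad n) := by
  simpa [evalIn] using isGradSequence_grad.map (evalIn D k : DiffPoly →+* A) (evalIn_D D k)

end EvalIn

end DiffPoly

section SmoothPeriodic

variable {V : Type*} [NormedAddCommGroup V] [NormedSpace ℝ V] {c : V}

/-- The algebra of smooth real functions on `V` with period `c`. -/
def smoothPeriodic (c : V) : Subalgebra ℝ (V → ℝ) where
  carrier := {f | ContDiff ℝ ∞ f ∧ Function.Periodic f c}
  mul_mem' hf hg := ⟨hf.1.mul hg.1, hf.2.mul hg.2⟩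
  add_mem' hf hg := ⟨hf.1.add hg.1, hf.2.add hg.2⟩
  algebraMap_mem' _ := ⟨contDiff_const, fun _ => rfl⟩

instance : CoeFun (smoothPeriodic c) fun _ => V → ℝ := ⟨Subtype.val⟩

theorem differentiable_coe (f : smoothPeriodic c) : Differentiable ℝ f :=
  f.2.1.differentiable (by simp)

/-- The derivative in the direction of `v`. -/
noncomputable def directionalDeriv (v : V) : Derivation ℝ (smoothPeriodic c) (smoothPeriodic c) :=
  Derivation.mk'
    { toFun := fun f => ⟨fun x => fderiv ℝ f x v,
        (f.2.1.fderiv_right (by simp)).clm_apply contDiff_const, fun x => by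
          simp only [← fderiv_comp_add_right, funext f.2.2]⟩
      map_add' := fun f g => by
        ext x
        exact congrArg (· v) (fderiv_add (differentiable_coe f x) (differentiable_coe g x))
      map_smul' := fun r f => by
        ext x
        exact congrArg (· v) (fderiv_const_smul (differentiable_coe f x) r) }
    fun f g => by
      ext x
      exact congrArg (· v) (fderiv_mul (differentiable_coe f x) (differentiable_coe g x))

theorem directionalDeriv_comm (v w : V) (f : smoothPeriodic c) :
    directionalDeriv v (directionalDeriv w f) = directionalDeriv w (directionalDeriv v f) := by
  ext x
  have hd : DifferentiableAt ℝ (fderiv ℝ f) x :=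
    (f.2.1.fderiv_right (m := ∞) (by simp)).differentiable (by simp) x
  have hsymm : IsSymmSndFDerivAt ℝ f x := f.2.1.contDiffAt.isSymmSndFDerivAt <| by
    rw [minSmoothness_of_isRCLikeNormedField]
    exact WithTop.coe_le_coe.2 le_top
  have hsnd (u u' : V) :
      directionalDeriv u (directionalDeriv u' f) x = fderiv ℝ (fderiv ℝ f) x u u' := by
    change fderiv ℝ (fun y => fderiv ℝ f y u') x u = _
    simp [fderiv_clm_apply hd (differentiableAt_const _)]
  rw [hsnd, hsnd, hsymm.eq]

theorem hasDerivAt_comp_directionalDeriv (f : smoothPeriodic c) {φ : ℝ → V} {v : V} {r : ℝ}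
    (hφ : HasDerivAt φ v r) : HasDerivAt (fun r => f (φ r)) (directionalDeriv v f (φ r)) r :=
  (differentiable_coe f (φ r)).hasFDerivAt.comp_hasDerivAt r hφ

end SmoothPeriodic

/-- The differential algebra of smooth functions on `S¹`. -/
abbrev CircleFun : Type := smoothPeriodic (2 * Real.pi)

namespace CircleFun

instance : CanLift (ℝ → ℝ) CircleFun Subtype.val IsCircleFun :=
  ⟨fun f hf => ⟨⟨f, hf.smooth, hf.periodic⟩, rfl⟩⟩

theorem isCircleFun (f : CircleFun) : IsCircleFun f := ⟨f.2.1, f.2.2⟩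

/-- The derivation `D_s` of `C^∞(S¹)`. -/
noncomputable abbrev ds : Derivation ℝ CircleFun CircleFun := directionalDeriv 1

theorem hasDerivAt (f : CircleFun) (s : ℝ) : HasDerivAt f (ds f s) s :=
  hasDerivAt_comp_directionalDeriv f (hasDerivAt_id s)

theorem deriv_coe (f : CircleFun) : deriv f = ds f := funext fun s => (f.hasDerivAt s).deriv

theorem iteratedDeriv_coe (f : CircleFun) (i : ℕ) : iteratedDeriv i f = (ds^[i] f).1 := by
  induction i with
  | zero => simp
  | succ i ih => rw [iteratedDeriv_succ, ih, deriv_coe, Function.iterate_succ_apply']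

theorem intervalIntegrable (f : CircleFun) (a b : ℝ) :
    IntervalIntegrable f MeasureTheory.volume a b :=
  f.2.1.continuous.intervalIntegrable a b

/-- The integral over `S¹`, as a linear functional. -/
noncomputable def integral : CircleFun →ₗ[ℝ] ℝ where
  toFun f := ∫ s in (0 : ℝ)..(2 * Real.pi), f s
  map_add' f g :=
    intervalIntegral.integral_add (f.intervalIntegrable _ _) (g.intervalIntegrable _ _)
  map_smul' r f := intervalIntegral.integral_const_mul r f

theorem integral_ds (f : CircleFun) : integral (ds f) = 0 := by
  change ∫ s in (0 : ℝ)..(2 * Real.pi), ds f s = 0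
  rw [intervalIntegral.integral_eq_sub_of_hasDerivAt (fun s _ => f.hasDerivAt s)
    ((ds f).intervalIntegrable _ _)]
  simpa using sub_eq_zero.2 (f.2.2 0)

end CircleFun

theorem IsCircleFun.exists_primitive {f : ℝ → ℝ} (hf : IsCircleFun f)
    (h : ∫ s in (0 : ℝ)..(2 * Real.pi), f s = 0) : ∃ p, IsCircleFun p ∧ deriv p = f := by
  have hd (s : ℝ) : HasDerivAt (fun s => ∫ x in (0 : ℝ)..s, f x) (f s) s :=
    (hf.smooth.continuous.integral_hasStrictDerivAt 0 s).hasDerivAt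
  have hderiv : deriv (fun s => ∫ x in (0 : ℝ)..s, f x) = f := funext fun s => (hd s).deriv
  refine ⟨_, ⟨contDiff_infty_iff_deriv.2 ⟨fun s => (hd s).differentiableAt, ?_⟩, fun s => ?_⟩,
    hderiv⟩
  · rw [hderiv]
    exact hf.smooth
  · have hint (a b : ℝ) : IntervalIntegrable f MeasureTheory.volume a b :=
      hf.smooth.continuous.intervalIntegrable a b
    have hs := hf.periodic.intervalIntegral_add_eq s 0
    rw [zero_add, h] at hs
    rw [← intervalIntegral.integral_add_adjacent_intervals (hint 0 s) (hint s _), hs, add_zero]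

/-- The differential algebra of smooth one-parameter families of functions on `S¹`, as functions of
the parameter `t` and the point `s`. -/
abbrev CircleFamily : Type := smoothPeriodic ((0, 2 * Real.pi) : ℝ × ℝ)

namespace CircleFamily

open CircleFun (ds integral)

/-- The derivation `∂/∂s` of families of functions on `S¹`. -/
noncomputable abbrev partialS : Derivation ℝ CircleFamily CircleFamily := directionalDeriv (0, 1)

/-- The derivation `∂/∂t` of families of functions on `S¹`. -/
noncomputable abbrev partialT : Derivation ℝ CircleFamily CircleFamily := directionalDeriv (1, 0)

theorem hasDerivAt_partialT (F : CircleFamily) (t s : ℝ) :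
    HasDerivAt (fun t => F (t, s)) (partialT F (t, s)) t :=
  hasDerivAt_comp_directionalDeriv F ((hasDerivAt_id t).prodMk (hasDerivAt_const t s))

theorem hasDerivAt_partialS (F : CircleFamily) (t s : ℝ) :
    HasDerivAt (fun s => F (t, s)) (partialS F (t, s)) s :=
  hasDerivAt_comp_directionalDeriv F ((hasDerivAt_const s t).prodMk (hasDerivAt_id s))

/-- The member of a family at time `t`. -/
def slice (t : ℝ) : CircleFamily →ₐ[ℝ] CircleFun where
  toFun F := ⟨fun s => F (t, s), F.2.1.comp (contDiff_prodMk_right t), fun s => by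
    simpa using F.2.2 (t, s)⟩
  map_one' := rfl
  map_mul' _ _ := rfl
  map_zero' := rfl
  map_add' _ _ := rfl
  commutes' _ := rfl

theorem slice_partialS (t : ℝ) (F : CircleFamily) : slice t (partialS F) = ds (slice t F) :=
  Subtype.ext <| funext fun s => (F.hasDerivAt_partialS t s).unique ((slice t F).hasDerivAt s)

theorem hasDerivAt_integral_slice (F : CircleFamily) (t : ℝ) :
    HasDerivAt (fun t => integral (slice t F)) (integral (slice t (partialT F))) t := by
  obtain ⟨B, hB⟩ := ((isCompact_closedBall t 1).prod
    (isCompact_uIcc (a := 0) (b := 2 * Real.pi))).exists_bound_of_continuousOn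
    (partialT F).2.1.continuous.continuousOn
  exact (intervalIntegral.hasDerivAt_integral_of_dominated_loc_of_deriv_le (bound := fun _ => B)
    (F := fun t => slice t F) (F' := fun t => slice t (partialT F))
    (Metric.closedBall_mem_nhds t one_pos)
    (.of_forall fun x => (slice x F).2.1.continuous.aestronglyMeasurable)
    ((slice t F).intervalIntegrable _ _)
    (slice t (partialT F)).2.1.continuous.aestronglyMeasurable
    (.of_forall fun s hs x hx => hB (x, s) ⟨hx, Set.uIoc_subset_uIcc hs⟩)
    intervalIntegrable_const (.of_forall fun s _ x _ => F.hasDerivAt_partialT x s)).2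

end CircleFamily

namespace DiffPoly

open CircleFun CircleFamily

theorem evalAt_eq_evalIn (κ : CircleFun) (s : ℝ) (p : DiffPoly) :
    evalAt κ s p = evalIn ds κ p s := by
  let evalPoint : CircleFun →ₐ[ℝ] ℝ := (Pi.evalAlgHom ℝ (fun _ => ℝ) s).comp (Subalgebra.val _)
  change _ = evalPoint (evalIn ds κ p)
  rw [evalIn, MvPolynomial.comp_aeval_apply, evalAt]
  simp only [iteratedDeriv_coe]
  rfl

theorem density_succ (n : ℕ) : density (n + 1) = (2 * n + 1 : ℝ)⁻¹ • grad (n + 1) := by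
  rw [density, MvPolynomial.smul_eq_C_mul]
  congr 2
  push_cast
  ring

theorem exists_variation_density_succ_eq {A : Type*} [CommRing A] [Algebra ℝ A]
    {D δ : Derivation ℝ A A} (hδ : ∀ a, δ (D a) = D (δ a)) (k : A) (n : ℕ) :
    ∃ w, δ (evalIn D k (density (n + 1))) = evalIn D k (grad n) * δ k + D w := by
  obtain ⟨w, hw⟩ := (isGradSequence_evalIn D k).exists_variation_succ_eq (isUnit_two A) hδ n
  have hn : (2 * n + 1 : ℝ) ≠ 0 := by positivity
  have hsmul : (2 * n + 1 : A) * (evalIn D k (grad n) * δ k) =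
      (2 * n + 1 : ℝ) • (evalIn D k (grad n) * δ k) := by
    simp only [Algebra.smul_def, map_add, map_mul, map_ofNat, map_natCast, map_one]
  refine ⟨(2 * n + 1 : ℝ)⁻¹ • w, ?_⟩
  rw [density_succ, map_smul, δ.map_smul, hw, hsmul, smul_add, inv_smul_smul₀ hn, D.map_smul]

theorem hasDerivAt_integral_density (K : CircleFamily) (n : ℕ) (t : ℝ) :
    HasDerivAt (fun t => integral (evalIn ds (slice t K) (density (n + 1))))
      (integral (evalIn ds (slice t K) (grad n) * slice t (partialT K))) t := by
  obtain ⟨w, hw⟩ := exists_variation_density_succ_eq (D := partialS) (δ := partialT)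
    (fun F => directionalDeriv_comm _ _ F) K n
  have h := hasDerivAt_integral_slice (evalIn partialS K (density (n + 1))) t
  rw [hw] at h
  simpa only [map_add, map_mul, slice_partialS, integral_ds, add_zero,
    map_evalIn _ (slice_partialS _)] using h

theorem integral_grad_mul_half_lenardOp (κ p : CircleFun) (n : ℕ) :
    integral (evalIn ds κ (grad n) * (1 / 2 : ℝ) • lenardOp ds κ p) =
      integral (evalIn ds κ (grad (n + 1)) * ds p) := by
  set g := fun n => evalIn ds κ (grad n)
  have lenard : 2 * ds (g (n + 1)) = lenardOp ds κ (g n) :=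
    (isGradSequence_evalIn ds κ).two_mul_deriv_succ (isUnit_two _) n
  obtain ⟨w, hw⟩ := exists_mul_lenardOp_add_eq_deriv ds κ (g n) p
  have parts : g n * lenardOp ds κ p =
      (2 : ℝ) • (g (n + 1) * ds p) + ds (w - (2 : ℝ) • (g (n + 1) * p)) := by
    rw [map_sub, Derivation.map_smul, Derivation.leibniz, ← hw, ← lenard, two_smul, two_smul,
      smul_eq_mul, smul_eq_mul]
    ring
  rw [mul_smul_comm, parts, map_smul, map_add, integral_ds, add_zero, map_smul, smul_smul,
    one_div_mul_cancel two_ne_zero, one_smul]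

end DiffPoly

section Curves

open CircleFun CircleFamily DiffPoly

theorem det₂_eq (v w : Fin 2 → ℝ) : det₂ v w = v 0 * w 1 - v 1 * w 0 := by
  simp [det₂, Matrix.det_fin_two]

namespace IsCurve

variable {γ : ℝ → Fin 2 → ℝ}

/-- The coordinates of a closed curve, as elements of `C^∞(S¹)`. -/
def coord (hγ : IsCurve γ) (i : Fin 2) : CircleFun :=
  ⟨fun s => γ s i, contDiff_pi.1 hγ.smooth i, fun s => congrFun (hγ.periodic s) i⟩

theorem deriv_apply (hγ : IsCurve γ) (s : ℝ) (i : Fin 2) : deriv γ s i = ds (hγ.coord i) s :=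
  congrFun (hasDerivAt_pi.2 fun j => (hγ.coord j).hasDerivAt s).deriv i

theorem deriv_deriv_apply (hγ : IsCurve γ) (s : ℝ) (i : Fin 2) :
    deriv (deriv γ) s i = ds (ds (hγ.coord i)) s := by
  have hderiv : deriv γ = fun s i => ds (hγ.coord i) s := by
    ext s i
    exact hγ.deriv_apply s i
  rw [hderiv]
  exact congrFun (hasDerivAt_pi.2 fun j => (ds (hγ.coord j)).hasDerivAt s).deriv i

theorem coord_mul_ds_sub (hγ : IsCurve γ) :
    hγ.coord 0 * ds (hγ.coord 1) - hγ.coord 1 * ds (hγ.coord 0) = 1 := by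
  ext s
  have := hγ.det_eq_one s
  rwa [det₂_eq, hγ.deriv_apply, hγ.deriv_apply] at this

/-- The curvature of a closed curve, as an element of `C^∞(S¹)`. -/
noncomputable def circleCurvature (hγ : IsCurve γ) : CircleFun :=
  wronskianCurvature ds (hγ.coord 0) (hγ.coord 1)

theorem coe_circleCurvature (hγ : IsCurve γ) : (hγ.circleCurvature : ℝ → ℝ) = curvature γ := by
  ext s
  simp only [curvature, det₂_eq, hγ.deriv_apply, hγ.deriv_deriv_apply]
  rfl

theorem isCircleFun_curvature (hγ : IsCurve γ) : IsCircleFun (curvature γ) :=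
  hγ.coe_circleCurvature ▸ hγ.circleCurvature.isCircleFun

theorem H_eq_integral (hγ : IsCurve γ) (m : ℕ) :
    H m γ = integral (evalIn ds hγ.circleCurvature (density m)) := by
  rw [H, ← hγ.coe_circleCurvature]
  simp only [evalAt_eq_evalIn]
  rfl

end IsCurve

namespace IsMotion

variable {γ X : ℝ → Fin 2 → ℝ} {Γ : ℝ → ℝ → Fin 2 → ℝ}

/-- The coordinates of a motion of closed curves, as families of functions on `S¹`. -/
def coord (h : IsMotion γ X Γ) (i : Fin 2) : CircleFamily :=
  ⟨fun p => Γ p.1 p.2 i, contDiff_pi.1 h.smooth i, fun p => by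
    simpa using congrFun ((h.isCurve p.1).periodic p.2) i⟩

theorem slice_coord (h : IsMotion γ X Γ) (t : ℝ) (i : Fin 2) :
    slice t (h.coord i) = (h.isCurve t).coord i := rfl

theorem coord_mul_partialS_sub (h : IsMotion γ X Γ) :
    h.coord 0 * partialS (h.coord 1) - h.coord 1 * partialS (h.coord 0) = 1 := by
  ext ⟨t, s⟩
  have hslice : slice t (h.coord 0 * partialS (h.coord 1) - h.coord 1 * partialS (h.coord 0)) =
      1 := by
    simpa only [map_sub, map_mul, slice_partialS, slice_coord] using
      (h.isCurve t).coord_mul_ds_sub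
  exact congrFun (congrArg Subtype.val hslice) s

/-- The curvatures of the curves of a motion, as a family of functions on `S¹`. -/
noncomputable def circleCurvature (h : IsMotion γ X Γ) : CircleFamily :=
  wronskianCurvature partialS (h.coord 0) (h.coord 1)

theorem slice_circleCurvature (h : IsMotion γ X Γ) (t : ℝ) :
    slice t h.circleCurvature = (h.isCurve t).circleCurvature := by
  simp only [circleCurvature, IsCurve.circleCurvature, wronskianCurvature, map_sub, map_mul,
    slice_partialS, slice_coord]

theorem velocity_apply (h : IsMotion γ X Γ) (s : ℝ) (i : Fin 2) :
    X s i = partialT (h.coord i) (0, s) := by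
  rw [← h.velocity]
  exact congrFun (hasDerivAt_pi.2 fun j => (h.coord j).hasDerivAt_partialT 0 s).deriv i

theorem slice_coord_mul_partialT_sub {α : ℝ → ℝ} (h : IsMotion γ (fieldOf γ α) Γ) (s : ℝ) :
    slice 0 (h.coord 0 * partialT (h.coord 1) - h.coord 1 * partialT (h.coord 0)) s = α s := by
  have hdet := (h.isCurve 0).det_eq_one s
  rw [h.start, det₂_eq] at hdet
  change Γ 0 s 0 * partialT (h.coord 1) (0, s) - Γ 0 s 1 * partialT (h.coord 0) (0, s) = α s
  rw [← h.velocity_apply, ← h.velocity_apply, h.start]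
  simp only [fieldOf, Pi.add_apply, Pi.smul_apply, smul_eq_mul]
  linear_combination α s * hdet

theorem slice_partialT_circleCurvature {α : CircleFun} (h : IsMotion γ (fieldOf γ α) Γ) :
    slice 0 (partialT h.circleCurvature) =
      (1 / 2 : ℝ) • lenardOp ds (h.isCurve 0).circleCurvature α := by
  have hα : slice 0 (h.coord 0 * partialT (h.coord 1) - h.coord 1 * partialT (h.coord 0)) = α :=
    Subtype.ext (funext h.slice_coord_mul_partialT_sub)
  have := congrArg (slice 0) (two_mul_variation_wronskianCurvature (D := partialS) (δ := partialT)
    (fun F => directionalDeriv_comm _ _ F) h.coord_mul_partialS_sub)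
  rw [map_lenardOp _ (slice_partialS 0), hα, ← circleCurvature, h.slice_circleCurvature] at this
  rw [← this, two_mul (partialT h.circleCurvature), ← two_smul ℝ, map_smul, smul_smul,
    one_div_mul_cancel two_ne_zero, one_smul]

end IsMotion

theorem integral_grad_mul_ds_eq_zero {m : ℕ} {γ : ℝ → Fin 2 → ℝ} (hγ : IsCurve γ)
    {α : CircleFun} (hX : fieldOf γ α ∈ tangentSpace m γ) {k : ℕ} (hk : k ≤ m) :
    integral (evalIn ds hγ.circleCurvature (grad k) * ds α) = 0 := by
  obtain ⟨Γ, hΓ, hH⟩ := hX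
  obtain rfl := hΓ.start
  cases k with
  | zero => rw [grad, map_one, one_mul, integral_ds]
  | succ n =>
    have firstVariation := hasDerivAt_integral_density hΓ.circleCurvature n 0
    simp only [hΓ.slice_circleCurvature, ← IsCurve.H_eq_integral] at firstVariation
    rw [← integral_grad_mul_half_lenardOp, ← hΓ.slice_partialT_circleCurvature]
    exact firstVariation.unique (hH (n + 1) (by omega) hk)

end Curves

section OmegaPowers

open CircleFun DiffPoly

theorem omega_deriv_eq (κ p : CircleFun) :
    omega κ (deriv p) p = ((1 / 2 : ℝ) • lenardOp ds κ p : CircleFun) := by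
  ext s
  simp only [omega, deriv_coe]
  change _ = 1 / 2 * (ds (ds (ds p)) s + 4 * κ s * ds p s + 2 * ds κ s * p s)
  ring

theorem IsOmegaPower.exists_eq {κ α : CircleFun} {k : ℕ} {f : ℝ → ℝ} (h : IsOmegaPower κ α k f) :
    ∃ F : CircleFun, f = F ∧ ∀ j,
      integral (evalIn ds κ (grad j) * F) = integral (evalIn ds κ (grad (j + k)) * ds α) := by
  induction h with
  | one => exact ⟨_, omega_deriv_eq κ α, integral_grad_mul_half_lenardOp κ α⟩
  | @succ _ _ p _ hp hpf ih =>
    obtain ⟨F, rfl, hF⟩ := ih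
    lift p to CircleFun using hp
    have hpF : ds p = F := Subtype.ext ((deriv_coe p).symm.trans hpf)
    refine ⟨_, hpf ▸ omega_deriv_eq κ p, fun j => ?_⟩
    rw [integral_grad_mul_half_lenardOp, hpF, hF, add_right_comm, add_assoc]

theorem IsOmegaPower.isCircleFun {κ α f : ℝ → ℝ} {k : ℕ} (hκ : IsCircleFun κ)
    (hα : IsCircleFun α) (h : IsOmegaPower κ α k f) : IsCircleFun f := by
  lift κ to CircleFun using hκ
  lift α to CircleFun using hα
  obtain ⟨F, rfl, -⟩ := h.exists_eq
  exact F.isCircleFun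

theorem IsOmegaPower.integral_eq_zero {m k : ℕ} {γ : ℝ → Fin 2 → ℝ} {α f : ℝ → ℝ}
    (hγ : IsCurve γ) (hα : IsCircleFun α) (hX : fieldOf γ α ∈ tangentSpace m γ)
    (h : IsOmegaPower (curvature γ) α k f) (hk : k ≤ m) :
    ∫ s in (0 : ℝ)..(2 * Real.pi), f s = 0 := by
  lift α to CircleFun using hα
  rw [← hγ.coe_circleCurvature] at h
  obtain ⟨F, rfl, hF⟩ := h.exists_eq
  calc
    integral F
    _ = integral (evalIn ds hγ.circleCurvature (grad 0) * F) := by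
      rw [grad, map_one, one_mul]
    _ = integral (evalIn ds hγ.circleCurvature (grad k) * ds α) := by rw [hF, zero_add]
    _ = 0 := integral_grad_mul_ds_eq_zero hγ hX hk

theorem exists_isOmegaPower_of_forall_exists_primitive {κ α : ℝ → ℝ} {m : ℕ}
    (h : ∀ k ≤ m, ∀ f, IsOmegaPower κ α k f → ∃ p, IsCircleFun p ∧ deriv p = f)
    {k : ℕ} (hk : 1 ≤ k) (hkm : k ≤ m + 1) : ∃ f, IsOmegaPower κ α k f := by
  induction k, hk using Nat.le_induction with
  | base => exact ⟨_, .one⟩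
  | succ k _ ih =>
    obtain ⟨f, hf⟩ := ih (by omega)
    obtain ⟨p, hp, hpf⟩ := h k (by omega) f hf
    exact ⟨_, hf.succ hp hpf⟩

end OmegaPowers

end CentroAffine

theorem proposition3p2 (c : ℕ → ℝ) (m : ℕ) (hm : 1 ≤ m) (γ : ℝ → Fin 2 → ℝ)
    (hγ : γ ∈ CentroAffine.levelSet c m) (α : ℝ → ℝ) (hα : CentroAffine.IsCircleFun α)
    (hX : CentroAffine.fieldOf γ α ∈ CentroAffine.tangentSpace m γ) :
    (∀ k, 1 ≤ k → k ≤ m + 1 →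
      (∃ f, CentroAffine.IsOmegaPower (CentroAffine.curvature γ) α k f) ∧
      ∀ f, CentroAffine.IsOmegaPower (CentroAffine.curvature γ) α k f →
        CentroAffine.IsCircleFun f) ∧
    (∀ k, 1 ≤ k → k ≤ m →
      ∀ f, CentroAffine.IsOmegaPower (CentroAffine.curvature γ) α k f →
        (∃ p, CentroAffine.IsCircleFun p ∧ deriv p = f) ∧
        ∫ s in (0 : ℝ)..(2 * Real.pi), f s = 0) := by
  have smooth {k f} (hf : CentroAffine.IsOmegaPower (CentroAffine.curvature γ) α k f) :
      CentroAffine.IsCircleFun f := hf.isCircleFun hγ.1.isCircleFun_curvature hα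
  have mean_zero {k f} (hk : k ≤ m)
      (hf : CentroAffine.IsOmegaPower (CentroAffine.curvature γ) α k f) :
      ∫ s in (0 : ℝ)..(2 * Real.pi), f s = 0 := hf.integral_eq_zero hγ.1 hα hX hk
  have exists_primitive k (hk : k ≤ m) f
      (hf : CentroAffine.IsOmegaPower (CentroAffine.curvature γ) α k f) :
      ∃ p, CentroAffine.IsCircleFun p ∧ deriv p = f :=
    (smooth hf).exists_primitive (mean_zero hk hf)
  exact ⟨fun k hk hkm => ⟨CentroAffine.exists_isOmegaPower_of_forall_exists_primitive
      exists_primitive hk hkm, fun _ => smooth⟩,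
    fun k _ hkm f hf => ⟨exists_primitive k hkm f hf, mean_zero hkm hf⟩⟩
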